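/- Let $n\ge 0$ and $r\in\{1,2,\dots\}\cup\{\infty\}$. By an $n$-dimensional $C^r$-manifold we mean a Hausdorff second countable $n$-dimensional manifold of smoothness class $C^r$, possibly with boundary (charts take values in $\mathbb{R}^n$ or in a closed half-space of $\mathbb{R}^n$); $\partial X$ denotes the boundary of $X$. **Theorem.** Let $X$ and $Y$ be (nonempty) connected $C^r$-manifolds of equal dimension $n$, with $X$ compact. Let $f\colon X\to Y$ be a $C^r$-mapping whose differential is nondegenerate on $X$, that is, $\operatorname{rank}(\mathrm{d}f_x)=n$ for every $x\in X$ (including boundary points), and suppose that $f(\partial X)\subseteq\partial Y$. Suppose that no proper subgroup of finite index in the fundamental group $\pi_1(Y)$ is isomorphic to $\pi_1(X)$. Then $f$ is a $C^r$-diffeomorphism of $X$ onto $Y$: it is bijective, and its inverse is also of class $C^r$. -/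

import Mathlib

open scoped Manifold ContDiff

/-- `I` models `n`-dimensional manifolds with (possibly empty) boundary, without corners: it
identifies the model space `H` either with the whole of `ℝⁿ` or with a closed half-space
`{x | 0 ≤ x i}` cut out by one of the coordinates. Both `𝓡 n` and `𝓡∂ n` are of this kind. -/
def IsBoundaryModel {n : ℕ} {H : Type*} [TopologicalSpace H]
    (I : ModelWithCorners ℝ (EuclideanSpace ℝ (Fin n)) H) : Prop :=
  Set.range I = Set.univ ∨ ∃ i : Fin n, Set.range I = {x | 0 ≤ x i}

/-!
The map `f` is shown to be a local homeomorphism, hence a covering map, since `X` is compact; the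
condition on fundamental groups then forces the covering to have a single sheet.

*Local step.* In charts, `f` is a `C¹` map between convex sets `S = range I` and `T = range J` with
invertible derivative at the point in question. It agrees near this point with a homeomorphism `g`
of `ℝⁿ` (`Convex.exists_homeomorph_extension`). At a boundary point `g` has still to be shown to map
`S` onto a neighbourhood in `T`. Since `f(∂X) ⊆ ∂Y`, the preimage under `g` of a small ball cut with
the interior of `T` is a connected set avoiding the frontier of `S`; it contains points of `S`, so it
lies in `S`, and the rest of `T` follows by taking closures
(`Homeomorph.map_nhdsWithin_eq_of_convex`). Half-spaces enter here as closed
convex sets that are the closure of their interior.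

*Global step.* The covering `f` is surjective, with finite fibres. The stabilizer of `x₀` under the
monodromy action of `π₁(Y, f x₀)` on the fibre has finite index and is the image of the injective
homomorphism induced by `f`, so it is isomorphic to `π₁(X, x₀)`. By hypothesis it is the whole group,
and then `f` is injective (`IsCoveringMap.injective_of_forall_subgroup_isEmpty_mulEquiv`).

*Regularity.* The inverse is continuous, and its derivative is the inverse of the derivative of `f`,
so it is `C^r` up to the boundary (`ContDiffWithinAt.of_local_left_inverse`).
-/

open Set Filter Topology

/-! ### Covering maps and fundamental groups -/

namespace IsCoveringMap

variable {X Y : Type*} [TopologicalSpace X] [TopologicalSpace Y] {p : X → Y}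

/-- A loop fixes the base point of the fibre under monodromy if and only if it lifts to a loop. -/
theorem monodromy_eq_self_iff_mem_range_map (cov : IsCoveringMap p) (x : X)
    (γ : FundamentalGroup Y (p x)) :
    cov.monodromy γ ⟨x, rfl⟩ = ⟨x, rfl⟩ ↔
      γ ∈ (FundamentalGroup.map ⟨p, cov.continuous⟩ x).range := by
  constructor
  · intro h
    have key := cov.map_liftPathQuotient γ ⟨x, rfl⟩
    -- The endpoint of the lift is only propositionally equal to `x`: generalize it first.
    have : ∀ (z : p ⁻¹' {p x}) (Γ : Path.Homotopic.Quotient x z.1), z = ⟨x, rfl⟩ →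
        Γ.map ⟨p, cov.continuous⟩ = (FundamentalGroup.toPath γ).cast rfl z.2 →
        ∃ Δ : Path.Homotopic.Quotient x x, Δ.map ⟨p, cov.continuous⟩ = γ := by
      rintro z Γ rfl h
      exact ⟨Γ, h.trans (Path.Homotopic.Quotient.cast_rfl_rfl _)⟩
    obtain ⟨Δ, hΔ⟩ := this _ _ h key
    exact ⟨Δ, hΔ⟩
  · rintro ⟨Δ, rfl⟩
    exact cov.monodromy_map Δ

/-- A path-connected covering space in which every loop at `p x` lifts to a loop at `x` is
one-sheeted. -/
theorem injective_of_monodromy_fixes (cov : IsCoveringMap p) [PathConnectedSpace X] (x : X)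
    (h : ∀ γ : FundamentalGroup Y (p x), cov.monodromy γ ⟨x, rfl⟩ = ⟨x, rfl⟩) :
    Function.Injective p := by
  -- The fibre over `p x` is a single point, because a path from `x` to `a` projects to a loop.
  have aux (a : X) (ha : p a = p x) : a = x := by
    obtain ⟨α⟩ := PathConnectedSpace.joined x a
    have h1 := cov.monodromy_eq_of_map_eq (γ := (((Path.Homotopic.Quotient.mk α).map
      ⟨p, cov.continuous⟩).cast rfl ha.symm)) (ex := ⟨x, rfl⟩) (ey := ⟨a, ha⟩) (.mk α) rfl
    exact congrArg Subtype.val (h1.symm.trans (h _))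
  -- Monodromy along a path from `p a` to `p x` is a bijection between the fibres.
  intro a b hab
  obtain ⟨α⟩ := PathConnectedSpace.joined a x
  let γ := (Path.Homotopic.Quotient.mk α).map ⟨p, cov.continuous⟩
  have h1 : cov.monodromy γ ⟨a, rfl⟩ = ⟨x, rfl⟩ := cov.monodromy_map (.mk α)
  have h2 : cov.monodromy γ ⟨b, hab.symm⟩ = ⟨x, rfl⟩ :=
    Subtype.ext (aux _ (cov.monodromy γ ⟨b, hab.symm⟩).2)
  exact congrArg Subtype.val ((cov.monodromy_bijective γ).1 (h1.trans h2.symm))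

/-- If no proper subgroup of finite index in `π₁(Y)` is isomorphic to `π₁(X)`, a covering map
`X → Y` with a finite fibre is injective: the stabilizer of a point of the fibre under monodromy is
a subgroup of finite index isomorphic to `π₁(X)`. -/
theorem injective_of_forall_subgroup_isEmpty_mulEquiv (cov : IsCoveringMap p)
    [PathConnectedSpace X] [PathConnectedSpace Y] (x : X) (y : Y) [Finite (p ⁻¹' {p x})]
    (h : ∀ K : Subgroup (FundamentalGroup Y y), K.FiniteIndex → K ≠ ⊤ →
      IsEmpty (K ≃* FundamentalGroup X x)) : Function.Injective p := by
  let := cov.fundamentalGroupMulAction (p x)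
  let S := MulAction.stabilizer (FundamentalGroup Y (p x)) (⟨x, rfl⟩ : p ⁻¹' {p x})
  let e : FundamentalGroup Y (p x) ≃* FundamentalGroup Y y :=
    FundamentalGroup.fundamentalGroupMulEquivOfPathConnected _ _
  let φ := FundamentalGroup.map ⟨p, cov.continuous⟩ x
  have hS : S = φ.range := by
    ext γ
    exact cov.monodromy_eq_self_iff_mem_range_map x γ
  have hφ : Function.Injective φ := cov.injective_path_homotopic_map x x
  -- By orbit-stabilizer, the index is the size of an orbit in the finite fibre.
  have hfin : S.FiniteIndex := ⟨by
    rw [MulAction.index_stabilizer]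
    exact Set.ncard_ne_zero_of_mem (MulAction.mem_orbit_self _) (Set.toFinite _)⟩
  have hK : (S.map e.toMonoidHom).FiniteIndex :=
    ⟨(Subgroup.index_map_equiv S e).trans_ne hfin.index_ne_zero⟩
  have htop : S = ⊤ := by
    by_contra hne
    refine (h _ hK fun htop ↦ hne ?_).false
      ((e.subgroupMap S).symm.trans
        ((MulEquiv.subgroupCongr hS).trans (MonoidHom.ofInjective hφ).symm))
    exact Subgroup.map_injective e.injective
      (htop.trans (Subgroup.map_top_of_surjective _ e.surjective).symm)
  refine cov.injective_of_monodromy_fixes x fun γ ↦ ?_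
  have : γ ∈ S := htop ▸ Subgroup.mem_top γ
  exact this

end IsCoveringMap

/-! ### Local topology -/

/-- The model space of a real model with corners is locally path-connected, being homeomorphic to
a convex set. -/
theorem ModelWithCorners.locallyPathConnectedSpace {E H : Type*} [NormedAddCommGroup E]
    [NormedSpace ℝ E] [TopologicalSpace H] (I : ModelWithCorners ℝ E H) :
    LocallyPathConnectedSpace H := by
  have := I.convex_range.locallyPathConnectedSpace
  exact I.isClosedEmbedding.isEmbedding.toHomeomorph.isOpenEmbedding.locallyPathConnectedSpace

theorem IsLocalHomeomorph.of_isOpenMap {X Y : Type*} [TopologicalSpace X] [TopologicalSpace Y]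
    {f : X → Y} (hf : Continuous f) (ho : IsOpenMap f) (hi : ∀ x, ∃ U ∈ 𝓝 x, InjOn f U) :
    IsLocalHomeomorph f := by
  rw [isLocalHomeomorph_iff_isOpenEmbedding_restrict]
  intro x
  obtain ⟨U, hU, hinj⟩ := hi x
  obtain ⟨V, hVU, hV, hxV⟩ := mem_nhds_iff.1 hU
  exact ⟨V, hV.mem_nhds hxV, .of_continuous_injective_isOpenMap (hf.comp continuous_subtype_val)
    (injOn_iff_injective.1 (hinj.mono hVU)) (ho.domRestrict hV)⟩

/-- A homeomorphism which near `a` maps the closed set `S` into the convex set `T`, and no point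
outside the interior of `S` into the interior of `T`, maps `S` near `a` onto a neighbourhood of
`g a` in `T`. This replaces invariance of domain at points of the frontier. -/
theorem Homeomorph.map_nhdsWithin_eq_of_convex {E F : Type*} [TopologicalSpace E]
    [NormedAddCommGroup F] [NormedSpace ℝ F] (g : E ≃ₜ F) {S U : Set E} {T : Set F} {a : E}
    (hS : IsClosed S) (haS : a ∈ closure (interior S)) (hT : Convex ℝ T)
    (hTc : T ⊆ closure (interior T)) (hU : U ∈ 𝓝 a) (hmaps : MapsTo g (S ∩ U) T)
    (hint : ∀ x ∈ S ∩ U, g x ∈ interior T → x ∈ interior S) :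
    map g (𝓝[S] a) = 𝓝[T] (g a) := by
  have hUS : S ∩ U ∈ 𝓝[S] a := inter_mem self_mem_nhdsWithin (mem_nhdsWithin_of_mem_nhds hU)
  refine le_antisymm (tendsto_nhdsWithin_iff.2
    ⟨g.continuous.continuousAt.mono_left nhdsWithin_le_nhds, mem_of_superset hUS hmaps⟩) ?_
  have hV : g.symm ⁻¹' U ∈ 𝓝 (g a) :=
    g.symm.continuous.continuousAt.preimage_mem_nhds (by simpa using hU)
  obtain ⟨ε, hε, hVU⟩ := Metric.mem_nhds_iff.1 hV
  let V := Metric.ball (g a) ε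
  let P := g.symm '' (V ∩ interior T)
  have hPconn : IsPreconnected P :=
    ((convex_ball _ _).inter hT.interior).isPreconnected.image _ g.symm.continuous.continuousOn
  -- `P` avoids the frontier of `S` because `V ∩ interior T` avoids the frontier of `T`. Being
  -- connected, it lies on one side of that frontier, and near `a` it has points of `interior S`.
  have hPS : P ⊆ S := by
    by_contra hne
    have hcover : P ⊆ interior S ∪ Sᶜ := by
      rintro _ ⟨y, ⟨hyV, hyT⟩, rfl⟩
      by_cases hy : g.symm y ∈ S
      · exact .inl (hint _ ⟨hy, hVU hyV⟩ (by simpa using hyT))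
      · exact .inr hy
    have hmeet : (P ∩ interior S).Nonempty := by
      have hgV : IsOpen (g ⁻¹' V) := Metric.isOpen_ball.preimage g.continuous
      obtain ⟨x, hxV, hxS⟩ := mem_closure_iff.1 haS (g ⁻¹' V) hgV (Metric.mem_ball_self hε)
      refine ⟨x, ⟨g x, ⟨hxV, ?_⟩, by simp⟩, hxS⟩
      -- the image of an open set under `g` is open, so it lies in the interior of `T`
      refine interior_maximal (t := g '' (g ⁻¹' V ∩ interior S)) ?_
        (g.isOpenMap _ (hgV.inter isOpen_interior)) ⟨x, ⟨hxV, hxS⟩, rfl⟩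
      rintro _ ⟨z, ⟨hzV, hzS⟩, rfl⟩
      exact hmaps ⟨interior_subset hzS, by simpa using hVU hzV⟩
    obtain ⟨y, -, hyS, hyS'⟩ := hPconn _ _ isOpen_interior hS.isOpen_compl hcover hmeet
      (inter_compl_nonempty_iff.2 hne)
    exact hyS' (interior_subset hyS)
  have hsymm : Tendsto g.symm (𝓝[T] (g a)) (𝓝[S] a) := by
    refine tendsto_nhdsWithin_iff.2 ⟨?_, ?_⟩
    · simpa using (g.symm.continuous.continuousAt (x := g a)).mono_left nhdsWithin_le_nhds
    · filter_upwards [self_mem_nhdsWithin, mem_nhdsWithin_of_mem_nhds (Metric.ball_mem_nhds _ hε)]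
        with y hyT hyV
      -- Frontier points of `T` are limits of interior points, and `S` is closed.
      have hy : y ∈ closure (V ∩ interior T) :=
        Metric.isOpen_ball.inter_closure ⟨hyV, hTc hyT⟩
      exact closure_minimal hPS hS (image_closure_subset_closure_image g.symm.continuous
        ⟨y, hy, rfl⟩)
  calc 𝓝[T] (g a) = map g (map g.symm (𝓝[T] (g a))) := by simp [map_map]
    _ ≤ map g (𝓝[S] a) := map_mono hsymm

/-! ### Inverse functions on sets with boundary -/

section InverseFunction

variable {E : Type*} [NormedAddCommGroup E] [NormedSpace ℝ E]
  {F : Type*} [NormedAddCommGroup F] [NormedSpace ℝ F]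

/-- A `C¹` function on a convex set with invertible derivative at a point `a` of the set, possibly
on its frontier, agrees near `a` with a homeomorphism of the whole space: by the mean value
inequality it is, near `a`, a Lipschitz perturbation of its derivative with a small constant. -/
theorem Convex.exists_homeomorph_extension [FiniteDimensional ℝ F] {f : E → F} {S : Set E}
    {a : E} (hS : Convex ℝ S) (hSa : UniqueDiffWithinAt ℝ S a) (ha : a ∈ S)
    (hf : ContDiffWithinAt ℝ 1 f S a)
    {A : E ≃L[ℝ] F} (hA : HasFDerivWithinAt f (A : E →L[ℝ] F) S a) :
    ∃ g : E ≃ₜ F, ∃ U ∈ 𝓝 a, EqOn f g (S ∩ U) := by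
  obtain ⟨u, hu, huS, -, f', hff', hf'⟩ :=
    (contDiffWithinAt_succ_iff_hasFDerivWithinAt' (n := 0) (by simp)).1 (by simpa using hf)
  rw [insert_eq_of_mem ha] at hu huS
  have hau : a ∈ u := mem_of_mem_nhdsWithin ha hu
  have hAa : f' a = A := hSa.eq (hff' a hau) hA
  -- The constant below which a Lipschitz perturbation of `A` extends to a homeomorphism.
  obtain ⟨c, hc0, hc⟩ : ∃ c : NNReal, 0 < c ∧
      (Subsingleton E ∨ lipschitzExtensionConstant F * c < ‖(A.symm : F →L[ℝ] E)‖₊⁻¹) := by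
    rcases subsingleton_or_nontrivial E with h | h
    · exact ⟨1, one_pos, .inl h⟩
    · have hN : 0 < ‖(A.symm : F →L[ℝ] E)‖₊⁻¹ := inv_pos.2 A.nnnorm_symm_pos
      have hL : 0 < lipschitzExtensionConstant F := lipschitzExtensionConstant_pos F
      refine ⟨‖(A.symm : F →L[ℝ] E)‖₊⁻¹ / 2 / lipschitzExtensionConstant F, by positivity,
        .inr ?_⟩
      rw [mul_div_cancel₀ _ hL.ne']
      exact NNReal.half_lt_self hN.ne'
  have hev : ∀ᶠ x in 𝓝[S] a, x ∈ u ∧ ‖f' x - A‖ ≤ c := by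
    refine Filter.Eventually.and hu ?_
    have h0 : Tendsto f' (𝓝[S] a) (𝓝 (f' a)) := hf'.continuousWithinAt
    have : Tendsto (fun x ↦ ‖f' x - A‖) (𝓝[S] a) (𝓝 0) := by
      simpa [hAa] using (h0.sub_const (f' a)).norm
    exact (this.eventually_lt_const (NNReal.coe_pos.2 hc0)).mono fun _ ↦ le_of_lt
  obtain ⟨δ, hδ, hball⟩ := Metric.mem_nhdsWithin_iff.1 hev
  have happ : ApproximatesLinearOn f (A : E →L[ℝ] F) (S ∩ Metric.ball a δ) c := by
    intro x hx y hy
    -- Convexity makes the mean value inequality available on `S ∩ ball a δ`.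
    refine (hS.inter (convex_ball a δ)).norm_image_sub_le_of_norm_hasFDerivWithin_le'
      (f' := f') (fun z hz ↦ ?_) (fun z hz ↦ (hball ⟨hz.2, hz.1⟩).2) hy hx
    exact (hff' z (hball ⟨hz.2, hz.1⟩).1).mono inter_subset_left
  obtain ⟨g, hg⟩ := happ.exists_homeomorph_extension hc
  exact ⟨g, _, Metric.ball_mem_nhds a hδ, hg⟩

/-- The inverse of a `C^r` function on a set, as far as it exists and is continuous, is `C^r`
wherever the derivative is invertible. Its derivative is `y ↦ (f' (h y))⁻¹`, so regularity goes
up by induction. -/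
theorem ContDiffWithinAt.of_local_left_inverse [CompleteSpace E] {f : E → F} {h : F → E}
    {S : Set E} {T : Set F} {b : F} {r : ℕ∞} (hSa : UniqueDiffWithinAt ℝ S (h b)) (ha : h b ∈ S)
    (hb : b ∈ T)
    (hf : ContDiffWithinAt ℝ r f S (h b)) {A : E ≃L[ℝ] F}
    (hA : HasFDerivWithinAt f (A : E →L[ℝ] F) S (h b))
    (hh : ∀ᶠ y in 𝓝[T] b, Tendsto h (𝓝[T] y) (𝓝[S] (h y)))
    (hfh : ∀ᶠ y in 𝓝[T] b, f (h y) = y) : ContDiffWithinAt ℝ r h T b := by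
  have hhb : Tendsto h (𝓝[T] b) (𝓝[S] (h b)) := hh.self_of_nhdsWithin hb
  have hcont : ∀ᶠ y in 𝓝[T] b, ContinuousWithinAt h T y :=
    hh.mono fun y hy ↦ hy.mono_right nhdsWithin_le_nhds
  have key (k : ℕ) (hk : (k : ℕ∞) ≤ r) : ContDiffWithinAt ℝ k h T b := by
    induction k with
    | zero =>
      have : ContDiffWithinAt ℝ 0 h T b := by
        rw [contDiffWithinAt_zero hb]
        exact ⟨_, hcont, fun y hy ↦ hy.2.mono inter_subset_left⟩
      exact this
    | succ k ih =>
      have ih := ih (le_trans (by exact_mod_cast k.le_succ) hk)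
      have hfk : ContDiffWithinAt ℝ (k + 1 : ℕ) f S (h b) := hf.of_le (by exact_mod_cast hk)
      push_cast at hfk ⊢
      obtain ⟨u, hu, huS, -, f', hff', hf'⟩ :=
        (contDiffWithinAt_succ_iff_hasFDerivWithinAt' (by simp)).1 hfk
      rw [insert_eq_of_mem ha] at hu huS
      have hau : h b ∈ u := mem_of_mem_nhdsWithin ha hu
      have hAa : f' (h b) = A := hSa.eq (hff' _ hau) hA
      have hinv : ∀ᶠ x in 𝓝[S] (h b), f' x ∈ range ((↑) : (E ≃L[ℝ] F) → E →L[ℝ] F) := by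
        refine hf'.continuousWithinAt ?_
        rw [hAa]
        exact A.nhds
      have hev : ∀ᶠ y in 𝓝[T] b, y ∈ T ∧ h y ∈ u ∧
          f' (h y) ∈ range ((↑) : (E ≃L[ℝ] F) → E →L[ℝ] F) ∧
          Tendsto h (𝓝[T] y) (𝓝[S] (h y)) ∧ ∀ᶠ z in 𝓝[T] y, f (h z) = z := by
        filter_upwards [self_mem_nhdsWithin, hhb hu, hhb.eventually hinv, hh,
          eventually_eventually_nhdsWithin.2 hfh] with y h1 h2 h3 h4 h5
        exact ⟨h1, h2, h3, h4, h5⟩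
      obtain ⟨w, hw, hwp⟩ := eventually_iff_exists_mem.1 hev
      refine (contDiffWithinAt_succ_iff_hasFDerivWithinAt' (by simp)).2
        ⟨w, by rwa [insert_eq_of_mem hb], fun y hy ↦ .inr (hwp y hy).1, by simp,
          fun y ↦ (f' (h y)).inverse, ?_, ?_⟩
      · intro y hy
        obtain ⟨hyT, hyu, ⟨B, hB⟩, hty, hfy⟩ := hwp y hy
        have hd : HasFDerivWithinAt f (B : E →L[ℝ] F) S (h y) := hB ▸ hff' _ hyu
        simpa [← hB] using hd.of_local_left_inverse hty hyT hfy
      · have h1 : ContDiffWithinAt ℝ k (f' ∘ h) T b := by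
          have : ContDiffWithinAt ℝ k (f' ∘ h) (T ∩ h ⁻¹' S) b := hf'.comp_inter _ ih
          refine this.mono_of_mem_nhdsWithin (inter_mem self_mem_nhdsWithin ?_)
          exact hhb self_mem_nhdsWithin
        have h2 : ContDiffAt ℝ k ContinuousLinearMap.inverse ((f' ∘ h) b) := by
          simp only [Function.comp_apply, hAa]
          exact contDiffAt_map_inverse A
        exact h2.comp_contDiffWithinAt b h1
  rw [contDiffWithinAt_iff_forall_nat_le]
  intro m hm
  exact key m (by exact_mod_cast hm)

end InverseFunction

/-! ### Maps of full rank between manifolds with boundary -/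

section Manifold

variable {n : ℕ} {HX : Type*} [TopologicalSpace HX]
  {I : ModelWithCorners ℝ (EuclideanSpace ℝ (Fin n)) HX}
  {HY : Type*} [TopologicalSpace HY]
  {J : ModelWithCorners ℝ (EuclideanSpace ℝ (Fin n)) HY}
  {X : Type*} [TopologicalSpace X] [ChartedSpace HX X]
  {Y : Type*} [TopologicalSpace Y] [ChartedSpace HY Y] {f : X → Y} {x : X}

/-- A differential of full rank is a linear equivalence, in the preferred charts. -/
theorem MDifferentiableAt.exists_equiv_hasFDerivWithinAt (hf : MDifferentiableAt I J f x)
    (hrank : Module.finrank ℝ (LinearMap.range (mfderiv I J f x).toLinearMap) = n) :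
    ∃ A : EuclideanSpace ℝ (Fin n) ≃L[ℝ] EuclideanSpace ℝ (Fin n),
      HasFDerivWithinAt (writtenInExtChartAt I J x f)
        (A : EuclideanSpace ℝ (Fin n) →L[ℝ] EuclideanSpace ℝ (Fin n)) (range I)
        (extChartAt I x x) := by
  let D : EuclideanSpace ℝ (Fin n) →L[ℝ] EuclideanSpace ℝ (Fin n) := mfderiv I J f x
  have hsurj : Function.Surjective D.toLinearMap :=
    LinearMap.range_eq_top.1 (Submodule.eq_top_of_finrank_eq (hrank.trans (by simp)))
  refine ⟨(LinearEquiv.ofBijective D.toLinearMap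
    ⟨LinearMap.injective_iff_surjective.2 hsurj, hsurj⟩).toContinuousLinearEquiv, ?_⟩
  exact hf.hasMFDerivAt.2

/-- Being an interior point can be read off in any extended chart around the point, not only in
the preferred one. -/
theorem ModelWithCorners.isInteriorPoint_iff_extChartAt_mem_interior_range
    [IsManifold I 1 X] {z : X} (hz : z ∈ (extChartAt I x).source) :
    I.IsInteriorPoint z ↔ extChartAt I x z ∈ interior (range I) := by
  rw [extChartAt_source] at hz
  rw [I.isInteriorPoint_iff_of_mem_atlas one_ne_zero (chart_mem_atlas HX x) hz]
  exact ⟨fun h ↦ (chartAt HX x).interior_extend_target_subset_interior_range h,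
    fun h ↦ (chartAt HX x).mem_interior_extend_target ((chartAt HX x).map_source hz) h⟩

/-- The topological part of the inverse function theorem on manifolds with boundary: a `C¹` map
of full rank at `x` which maps boundary into boundary is open and injective near `x`. -/
theorem ContMDiffAt.map_nhds_eq_and_exists_injOn [IsManifold I 1 X] [IsManifold J 1 Y]
    (hf : ContMDiffAt I J 1 f x)
    (hrank : Module.finrank ℝ (LinearMap.range (mfderiv I J f x).toLinearMap) = n)
    (hboundary : MapsTo f (I.boundary X) (J.boundary Y)) :
    map f (𝓝 x) = 𝓝 (f x) ∧ ∃ U ∈ 𝓝 x, InjOn f U := by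
  obtain ⟨A, hA⟩ := (hf.mdifferentiableAt one_ne_zero).exists_equiv_hasFDerivWithinAt hrank
  have ha : extChartAt I x x ∈ range I := mem_range_self _
  obtain ⟨g, U, hU, hFg⟩ := I.convex_range.exists_homeomorph_extension
    (I.uniqueDiffOn _ ha) ha (contMDiffAt_iff.1 hf).2 hA
  set φ := extChartAt I x
  set ψ := extChartAt J (f x)
  -- A neighbourhood of `x` on which `f` is expressed in the two charts by `g`.
  let W : Set X := {z | z ∈ φ.source ∧ f z ∈ ψ.source ∧ φ z ∈ U}
  have hW : W ∈ 𝓝 x := inter_mem (extChartAt_source_mem_nhds x)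
    (inter_mem (hf.continuousAt (extChartAt_source_mem_nhds (f x)))
      ((continuousAt_extChartAt x) hU))
  have hxW : x ∈ W := mem_of_mem_nhds hW
  have hWeq {z : X} (hz : z ∈ W) : ψ (f z) = g (φ z) := by
    have := @hFg (φ z) ⟨mem_range_self _, hz.2.2⟩
    rwa [Function.comp_apply, Function.comp_apply, φ.left_inv hz.1] at this
  obtain ⟨U', hU', hUW⟩ : ∃ U' ∈ 𝓝 (φ x), ∀ z ∈ range I ∩ U', ∃ w ∈ W, φ w = z := by
    have : φ '' W ∈ 𝓝[range I] (φ x) := by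
      rw [← map_extChartAt_nhds]
      exact image_mem_map hW
    obtain ⟨U', hU', h⟩ := mem_nhdsWithin_iff_exists_mem_nhds_inter.1 this
    exact ⟨U', hU', fun z hz ↦ h ⟨hz.2, hz.1⟩⟩
  have hg : map g (𝓝[range I] (φ x)) = 𝓝[range J] (g (φ x)) := by
    refine g.map_nhdsWithin_eq_of_convex I.isClosed_range (I.range_subset_closure_interior ha)
      J.convex_range J.range_subset_closure_interior hU' ?_ ?_
    · intro z hz
      obtain ⟨w, hw, rfl⟩ := hUW z hz
      rw [← hWeq hw]
      exact mem_range_self _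
    · intro z hz hgz
      obtain ⟨w, hw, rfl⟩ := hUW z hz
      rw [← hWeq hw, ← J.isInteriorPoint_iff_extChartAt_mem_interior_range hw.2.1] at hgz
      rw [← I.isInteriorPoint_iff_extChartAt_mem_interior_range hw.1]
      by_contra h
      exact J.isInteriorPoint_iff_not_isBoundaryPoint _ |>.1 hgz
        (hboundary (I.isBoundaryPoint_iff_not_isInteriorPoint _ |>.2 h))
  refine ⟨?_, W, hW, fun z hz w hw hzw ↦ ?_⟩
  · have hfeq : f =ᶠ[𝓝 x] ψ.symm ∘ g ∘ φ := by
      filter_upwards [hW] with z hz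
      rw [Function.comp_apply, Function.comp_apply, ← hWeq hz, ψ.left_inv hz.2.1]
    rw [map_congr hfeq, ← map_map, ← map_map, map_extChartAt_nhds, hg, ← hWeq hxW,
      map_extChartAt_symm_nhdsWithin_range]
  · refine φ.injOn hz.1 hw.1 (g.injective ?_)
    rw [← hWeq hz, ← hWeq hw, hzw]

/-- A continuous inverse of a `C^r` map is `C^r` at the image of every point, boundary points
included, at which the map has full rank. -/
theorem ContMDiffAt.of_continuous_inverse {r : ℕ∞} (hr : 1 ≤ r)
    (hf : ContMDiffAt I J r f x)
    (hrank : Module.finrank ℝ (LinearMap.range (mfderiv I J f x).toLinearMap) = n)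
    {g : Y → X} (hg : Continuous g) (hgx : g (f x) = x) (hfg : ∀ y, f (g y) = y) :
    ContMDiffAt J I r g (f x) := by
  obtain ⟨A, hA⟩ := (hf.mdifferentiableAt (by exact_mod_cast (one_pos.trans_le hr).ne')
    ).exists_equiv_hasFDerivWithinAt hrank
  have ha : extChartAt I x x ∈ range I := mem_range_self _
  rw [contMDiffAt_iff]
  refine ⟨hg.continuousAt, ?_⟩
  rw [hgx]
  set φ := extChartAt I x
  set ψ := extChartAt J (f x)
  have hψx : ψ.symm (ψ (f x)) = f x := extChartAt_to_inv (f x)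
  have hhb : (φ ∘ g ∘ ψ.symm) (ψ (f x)) = φ x := by simp [hψx, hgx]
  have hev : ∀ᶠ y in 𝓝[range J] (ψ (f x)), y ∈ ψ.target ∧ g (ψ.symm y) ∈ φ.source := by
    refine inter_mem (extChartAt_target_mem_nhdsWithin (f x)) (mem_nhdsWithin_of_mem_nhds ?_)
    refine (hg.continuousAt.comp (continuousAt_extChartAt_symm (f x))).preimage_mem_nhds ?_
    simp only [Function.comp_apply]
    rw [hψx, hgx]
    exact extChartAt_source_mem_nhds x
  refine ContDiffWithinAt.of_local_left_inverse (f := writtenInExtChartAt I J x f)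
    (S := range I) (A := A) ?_ ?_ (mem_range_self _) ?_ ?_ ?_ ?_
  · rw [hhb]; exact I.uniqueDiffOn _ ha
  · rw [hhb]; exact ha
  · rw [hhb]; exact (contMDiffAt_iff.1 hf).2
  · rw [hhb]; exact hA
  · filter_upwards [hev] with y hy
    refine tendsto_nhdsWithin_iff.2 ⟨?_, .of_forall fun _ ↦ mem_range_self _⟩
    have h1 : ContinuousAt (g ∘ ψ.symm) y :=
      hg.continuousAt.comp (continuousAt_extChartAt_symm'' hy.1)
    have h2 : ContinuousAt φ ((g ∘ ψ.symm) y) := continuousAt_extChartAt' hy.2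
    exact (h2.comp h1).mono_left nhdsWithin_le_nhds
  · filter_upwards [hev] with y hy
    simp only [writtenInExtChartAt, Function.comp_apply]
    rw [φ.left_inv hy.2, hfg, ψ.right_inv hy.1]

end Manifold

theorem mainTheorem10 {n : ℕ} {r : ℕ∞} (hr : 1 ≤ r)
    {HX : Type*} [TopologicalSpace HX]
    (I : ModelWithCorners ℝ (EuclideanSpace ℝ (Fin n)) HX) (hI : IsBoundaryModel I)
    {HY : Type*} [TopologicalSpace HY]
    (J : ModelWithCorners ℝ (EuclideanSpace ℝ (Fin n)) HY) (hJ : IsBoundaryModel J)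
    {X : Type*} [TopologicalSpace X] [T2Space X] [SecondCountableTopology X]
    [ChartedSpace HX X] [IsManifold I r X] [ConnectedSpace X] [CompactSpace X]
    {Y : Type*} [TopologicalSpace Y] [T2Space Y] [SecondCountableTopology Y]
    [ChartedSpace HY Y] [IsManifold J r Y] [ConnectedSpace Y]
    (f : X → Y) (hf : ContMDiff I J r f)
    (hrank : ∀ x : X, Module.finrank ℝ (LinearMap.range (mfderiv I J f x).toLinearMap) = n)
    (hboundary : Set.MapsTo f (I.boundary X) (J.boundary Y))
    (x₀ : X) (y₀ : Y)
    (hpi : ∀ K : Subgroup (FundamentalGroup Y y₀), K.FiniteIndex → K ≠ ⊤ →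
      IsEmpty (K ≃* FundamentalGroup X x₀)) :
    ∃ Φ : X ≃ₘ^r⟮I, J⟯ Y, ⇑Φ = f := by
  have hr' : (1 : ℕ∞ω) ≤ r := by exact_mod_cast hr
  have : IsManifold I 1 X := .of_le hr'
  have : IsManifold J 1 Y := .of_le hr'
  have hloc (x : X) := ((hf x).of_le hr').map_nhds_eq_and_exists_injOn (hrank x) hboundary
  have hopen : IsOpenMap f := IsOpenMap.of_nhds_le fun x ↦ (hloc x).1.ge
  have cov : IsCoveringMap f := isLocalHomeomorph_iff_isCoveringMap.1 <|
    .of_isOpenMap hf.continuous hopen fun x ↦ (hloc x).2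
  have : LocallyPathConnectedSpace HX := I.locallyPathConnectedSpace
  have : LocallyPathConnectedSpace HY := J.locallyPathConnectedSpace
  have : LocallyPathConnectedSpace X := ChartedSpace.locallyPathConnectedSpace HX X
  have : LocallyPathConnectedSpace Y := ChartedSpace.locallyPathConnectedSpace HY Y
  have : PathConnectedSpace X := .of_locallyPathConnectedSpace
  have : PathConnectedSpace Y := .of_locallyPathConnectedSpace
  have hfiber : Finite (f ⁻¹' {f x₀}) := by
    have := (cov (f x₀)).discreteTopology_fiber
    have : CompactSpace (f ⁻¹' {f x₀}) :=
      isCompact_iff_compactSpace.1 (isClosed_singleton.preimage hf.continuous).isCompact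
    exact finite_of_compact_of_discrete
  have hinj : Function.Injective f :=
    cov.injective_of_forall_subgroup_isEmpty_mulEquiv x₀ y₀ hpi
  have hsurj : Function.Surjective f := range_eq_univ.1 <|
    IsClopen.eq_univ ⟨(isCompact_range hf.continuous).isClosed, hopen.isOpen_range⟩
      (range_nonempty f)
  let e : X ≃ₜ Y :=
    (Equiv.ofBijective f ⟨hinj, hsurj⟩).toHomeomorphOfContinuousOpen hf.continuous hopen
  refine ⟨⟨e.toEquiv, hf, fun y ↦ ?_⟩, rfl⟩
  obtain ⟨x, rfl⟩ := hsurj y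
  exact (hf x).of_continuous_inverse hr (hrank x) e.symm.continuous (e.symm_apply_apply x)
    e.apply_symm_apply
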